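/- All graphs are finite and simple. A $k$-coloring of a graph $G$ is a partition $\{S_1,\dots,S_k\}$ of $V(G)$ into $k$ non-empty independent sets (colors). It is neighbor-locating if for every two different vertices $u,v$ belonging to the same color, the sets $\{j : N(u)\cap S_j\neq\emptyset\}$ and $\{j : N(v)\cap S_j\neq\emptyset\}$ are different, where $N(x)$ denotes the neighborhood of $x$. The neighbor-locating chromatic number $\chi_{NL}(G)$ is the minimum number of colors of a neighbor-locating coloring of $G$. Let $P_n$ and $C_n$ denote the path and the cycle on $n$ vertices, and let $\ell(k)=\frac{k^3-k^2}{2}$. Theorem. Let $k,n$ be integers such that $k\ge 4$ and $\ell(k-1)<n\le \ell(k)$. Then (1) $\chi_{NL}(P_n)=k$; (2) $\chi_{NL}(C_n)=k$ if $n\neq \ell(k)-1$; (3) $\chi_{NL}(C_n)=k+1$ if $n=\ell(k)-1$. -/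

import Mathlib

namespace NeighborLocating

variable {V : Type*}

/-- The set of colors of the neighborhood of `v`, that is, `{j | N(v) ∩ S_j ≠ ∅}`, where
`S_j` is the color class of `j`. -/
def neighborColors (G : SimpleGraph V) {α : Type*} (c : G.Coloring α) (v : V) : Set α :=
  {j | ∃ w ∈ G.neighborSet v, c w = j}

/-- A proper coloring is neighbor-locating if any two different vertices of the same color
have different sets of colors on their neighborhoods. -/
def IsNLColoring (G : SimpleGraph V) {α : Type*} (c : G.Coloring α) : Prop :=
  ∀ u v : V, u ≠ v → c u = c v → neighborColors G c u ≠ neighborColors G c v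

/-- `G` has a neighbor-locating coloring with exactly `k` colors: a partition of the vertices
into `k` non-empty independent sets, indexed by `Fin k`, that is neighbor-locating. -/
def HasNLColoring (G : SimpleGraph V) (k : ℕ) : Prop :=
  ∃ c : G.Coloring (Fin k), Function.Surjective c ∧ IsNLColoring G c

/-- The neighbor-locating chromatic number: the least number of colors of a neighbor-locating
coloring of `G`. For a finite graph the minimum is attained, see `isLeast_chiNL`. -/
noncomputable def chiNL (G : SimpleGraph V) : ℕ :=
  sInf {k | HasNLColoring G k}

theorem hasNLColoring_card [Fintype V] (G : SimpleGraph V) :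
    HasNLColoring G (Fintype.card V) := by
  refine ⟨SimpleGraph.Coloring.mk (Fintype.equivFin V) ?_, (Fintype.equivFin V).surjective, ?_⟩
  · intro u v huv h
    exact huv.ne ((Fintype.equivFin V).injective h)
  · intro u v huv h
    exact absurd ((Fintype.equivFin V).injective h) huv

theorem isLeast_chiNL [Fintype V] (G : SimpleGraph V) :
    IsLeast {k | HasNLColoring G k} (chiNL G) :=
  ⟨Nat.sInf_mem ⟨_, hasNLColoring_card G⟩, fun _ hk => Nat.sInf_le hk⟩

/-- `ℓ(k) = (k³ - k²) / 2`; both the subtraction and the division are exact. -/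
def ell (k : ℕ) : ℕ := (k ^ 3 - k ^ 2) / 2

theorem two_mul_ell_add (k : ℕ) : 2 * ell k + k ^ 2 = k ^ 3 := by
  have h1 : k ^ 2 ≤ k ^ 3 := by
    rcases Nat.eq_zero_or_pos k with rfl | hk
    · simp
    · exact Nat.pow_le_pow_right hk (by norm_num)
  have h2 : 2 ∣ k ^ 3 - k ^ 2 := by
    have h : k ^ 3 - k ^ 2 = k * (k * (k - 1)) := by
      rw [Nat.mul_sub, Nat.mul_sub]
      ring_nf
    rw [h]
    exact (Nat.even_mul_pred_self k).two_dvd.mul_left k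
  unfold ell
  omega

end NeighborLocating

/-! In a path or cycle, give each vertex its type: its color together with the set of colors on its
closed neighborhood, a set of size 2 or 3. A coloring is neighbor-locating exactly when no type
repeats (`isNLColoring_iff`), and `k` colors offer 2·C(k,2) + 3·C(k,3) = ℓ(k) types. This gives the
lower bounds (`card_le_ell_chiNL`).

Conversely, a coloring is a walk on the colors without repeated types. All types over a pair or
triple can be added at once by a closed detour: after consecutive entries `u, v`, insert `u, v` or
`w, u, v` (`exists_extends_singleton`). Using every triple through one color `a` makes all further
sets reachable (`exists_extends_of_star`). Walks from `a, b` to `a, b` arise in this way with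
lengths 3t + 2e; the ends supply the two types over `{a, b}`, both in the path and in the cycle.

Omitting whole sets never omits exactly one type, so n = ℓ(k) - 1 is special. The path has an open
walk that misses one type (`exists_walk_ell_sub_one`). In a cycle, the edges colored `x, y` have as
many ends colored `x` as `y`; the collection of all types has this balance, and removing a single
type destroys it (`card_add_one_ne_ell`). -/

namespace NeighborLocating

/-! ### Walks on the colors and closed detours -/

section Walks

variable {α : Type*} [DecidableEq α]

/-- The types of the inner entries of a walk: an entry `b` between `a` and `c` has the type
`(b, {a, b, c})`. -/
def walkTypes : List α → List (α × Finset α)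
  | a :: b :: c :: l => (b, {a, b, c}) :: walkTypes (b :: c :: l)
  | _ => []

@[simp] theorem walkTypes_nil : walkTypes ([] : List α) = [] := rfl
@[simp] theorem walkTypes_singleton (a : α) : walkTypes [a] = [] := rfl
@[simp] theorem walkTypes_pair (a b : α) : walkTypes [a, b] = [] := rfl
@[simp] theorem walkTypes_cons (a b c : α) (l : List α) :
    walkTypes (a :: b :: c :: l) = (b, {a, b, c}) :: walkTypes (b :: c :: l) := rfl

/-- A type sees three consecutive entries, so cutting a walk with an overlap of two entries neither
loses nor duplicates a type. -/
theorem walkTypes_append (l : List α) (a b : α) (r : List α) :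
    walkTypes (l ++ a :: b :: r) = walkTypes (l ++ [a, b]) ++ walkTypes (a :: b :: r) := by
  induction l with
  | nil => simp
  | cons x l ih =>
    rcases l with _ | ⟨y, _ | ⟨z, l⟩⟩
    · simp
    · simp
    · simpa using ih

theorem length_walkTypes : ∀ l : List α, (walkTypes l).length = l.length - 2
  | [] => rfl
  | [_] => rfl
  | [_, _] => rfl
  | a :: b :: c :: l => by
    have := length_walkTypes (b :: c :: l)
    simp only [walkTypes_cons, List.length_cons] at this ⊢
    omega

theorem getElem_walkTypes : ∀ (l : List α) (j : ℕ) (h : j + 2 < l.length)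
    (h' : j < (walkTypes l).length), (walkTypes l)[j] = (l[j + 1], {l[j], l[j + 1], l[j + 2]})
  | [], j, h, _ => by simp at h
  | [_], j, h, _ => by simp at h
  | [_, _], j, h, _ => by simp at h
  | a :: b :: c :: l, 0, h, _ => by simp
  | a :: b :: c :: l, j + 1, h, h' => by
    have := getElem_walkTypes (b :: c :: l) j (by simpa using h) (by simpa using h')
    simpa using this

/-- Two entries are consecutive, in one order or the other, in a walk. -/
def Consecutive (l : List α) (u v : α) : Prop := [u, v] <:+: l ∨ [v, u] <:+: l

omit [DecidableEq α] in
theorem Consecutive.symm {l : List α} {u v : α} (h : Consecutive l u v) : Consecutive l v u :=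
  Or.symm h

/-- The walk `l'` arises from `l` by adding all types `(x, s)` with `x ∈ s ∈ P`. -/
structure Extends (P : Finset (Finset α)) (l l' : List α) : Prop where
  isChain : l.IsChain (· ≠ ·) → l'.IsChain (· ≠ ·)
  nodup : (walkTypes l).Nodup → (∀ t ∈ walkTypes l, t.2 ∉ P) → (walkTypes l').Nodup
  mem : ∀ t, t ∈ walkTypes l' ↔ t ∈ walkTypes l ∨ (t.2 ∈ P ∧ t.1 ∈ t.2)
  length : l'.length = l.length + ∑ s ∈ P, s.card
  pre : ∀ u v, [u, v] <+: l → [u, v] <+: l'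
  suf : ∀ u v, [u, v] <:+ l → [u, v] <:+ l'
  mono : ∀ u v, Consecutive l u v → Consecutive l' u v
  new : ∀ s ∈ P, ∀ u ∈ s, ∀ v ∈ s, u ≠ v → Consecutive l' u v

theorem Extends.refl (l : List α) : Extends ∅ l l where
  isChain := id
  nodup h _ := h
  mem t := by simp
  length := by simp
  pre _ _ := id
  suf _ _ := id
  mono _ _ := id
  new s hs := by simp at hs

theorem Extends.comp {P Q : Finset (Finset α)} {l l' l'' : List α} (h : Extends P l l')
    (h' : Extends Q l' l'') (hPQ : Disjoint P Q) : Extends (P ∪ Q) l l'' where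
  isChain := h'.isChain ∘ h.isChain
  nodup hl hP := by
    refine h'.nodup (h.nodup hl fun t ht hh => hP t ht (Finset.mem_union_left _ hh)) ?_
    intro t ht hq
    rcases (h.mem t).1 ht with h1 | h1
    · exact hP t h1 (Finset.mem_union_right _ hq)
    · exact Finset.disjoint_left.1 hPQ h1.1 hq
  mem t := by
    rw [h'.mem, h.mem, Finset.mem_union]
    tauto
  length := by rw [h'.length, h.length, Finset.sum_union hPQ, add_assoc]
  pre u v := h'.pre u v ∘ h.pre u v
  suf u v := h'.suf u v ∘ h.suf u v
  mono u v := h'.mono u v ∘ h.mono u v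
  new s hs u hu v hv huv := by
    rcases Finset.mem_union.1 hs with hs | hs
    · exact h'.mono u v (h.new s hs u hu v hv huv)
    · exact h'.new s hs u hu v hv huv

omit [DecidableEq α] in
theorem pair_infix_append_cons {l r : List α} {i u v : α} (h : [u, v] <:+: l ++ i :: r) :
    [u, v] <:+: l ++ [i] ∨ [u, v] <:+: i :: r := by
  induction l with
  | nil => exact .inr h
  | cons x l ih =>
    rw [List.cons_append, List.infix_cons_iff] at h
    rcases h with h | h
    · left
      rcases l with _ | ⟨y, l⟩
      · obtain ⟨rfl, rfl⟩ : u = x ∧ v = i := by simpa using h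
        exact List.infix_rfl
      · obtain ⟨rfl, rfl⟩ : u = x ∧ v = y := by simpa using h
        exact ⟨[], l ++ [i], by simp⟩
    · exact (ih h).imp_left List.infix_cons

/-- Closed detours: after the consecutive entries `i, a`, one may insert `m` followed by
`i, a`. -/
theorem extends_detour (l r m : List α) (i a : α) (s : Finset α)
    (hchain : (i :: a :: (m ++ [i, a])).IsChain (· ≠ ·))
    (hperm : (walkTypes (i :: a :: (m ++ [i, a]))).Nodup)
    (hmem : ∀ t, t ∈ walkTypes (i :: a :: (m ++ [i, a])) ↔ t.2 = s ∧ t.1 ∈ t.2)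
    (hlen : m.length + 2 = s.card)
    (hnew : ∀ u ∈ s, ∀ v ∈ s, u ≠ v → Consecutive (i :: a :: (m ++ [i, a])) u v) :
    Extends {s} (l ++ i :: a :: r) (l ++ i :: a :: (m ++ i :: a :: r)) := by
  have e1 : walkTypes (l ++ i :: a :: r) =
      walkTypes (l ++ [i, a]) ++ walkTypes (i :: a :: r) := walkTypes_append ..
  have e2 : walkTypes (l ++ i :: a :: (m ++ i :: a :: r)) =
      walkTypes (l ++ [i, a]) ++ (walkTypes (i :: a :: (m ++ [i, a])) ++
        walkTypes (i :: a :: r)) := by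
    rw [walkTypes_append]
    congr 1
    exact walkTypes_append (i :: a :: m) i a r
  have hinf : (i :: a :: (m ++ [i, a])) <:+: l ++ i :: a :: (m ++ i :: a :: r) :=
    ⟨l, r, by simp⟩
  have hpair : ∀ u v, [u, v] <:+: l ++ i :: a :: r →
      [u, v] <:+: l ++ i :: a :: (m ++ i :: a :: r) := by
    intro u v h
    rcases pair_infix_append_cons h with h | h
    · exact h.trans ⟨[], a :: (m ++ i :: a :: r), by simp⟩
    · exact h.trans ⟨l ++ i :: a :: m, [], by simp⟩
  constructor
  · intro h
    have h1 := List.isChain_append_cons_cons.1 h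
    have h2 : (i :: a :: (m ++ i :: a :: r)).IsChain (· ≠ ·) := by
      have h3 := hchain
      rw [← List.cons_append, ← List.cons_append, List.isChain_append_cons_cons] at h3
      rw [← List.cons_append, ← List.cons_append, List.isChain_append_cons_cons]
      exact ⟨h3.1, h1.2⟩
    exact List.isChain_split.2 ⟨h1.1, h2⟩
  · intro h hP
    rw [e1] at h hP
    rw [e2]
    have hd : ∀ t ∈ walkTypes (i :: a :: (m ++ [i, a])),
        t ∉ walkTypes (l ++ [i, a]) ++ walkTypes (i :: a :: r) := fun t ht ht' =>
      hP t ht' (by simpa using ((hmem t).1 ht).1)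
    simp only [List.nodup_append, List.mem_append, not_or] at h hd ⊢
    grind
  · intro t
    rw [e1, e2]
    simp only [List.mem_append, hmem, Finset.mem_singleton]
    tauto
  · simp
    omega
  · intro u v h
    rcases l with _ | ⟨x, _ | ⟨y, l⟩⟩ <;> simpa using h
  · intro u v h
    have h1 : i :: a :: r <:+ l ++ i :: a :: r := List.suffix_append ..
    refine (List.suffix_of_suffix_length_le h h1 (by simp)).trans ?_
    exact ⟨l ++ i :: a :: m, by simp⟩
  · rintro u v (h | h)
    · exact .inl (hpair _ _ h)
    · exact .inr (hpair _ _ h)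
  · intro s' hs u hu v hv huv
    rw [Finset.mem_singleton] at hs
    subst hs
    exact (hnew u hu v hv huv).imp (·.trans hinf) (·.trans hinf)

theorem exists_extends_singleton {l : List α} {s : Finset α} (hs : s.card = 2 ∨ s.card = 3)
    {u v : α} (huv : u ≠ v) (hu : u ∈ s) (hv : v ∈ s) (h : Consecutive l u v) :
    ∃ l', Extends {s} l l' := by
  wlog h' : [u, v] <:+: l generalizing u v
  · exact this huv.symm hv hu h.symm (h.resolve_left h')
  obtain ⟨p, q, rfl⟩ := h'
  simp only [List.append_assoc, List.cons_append, List.nil_append]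
  rcases hs with hs | hs
  · obtain rfl : {u, v} = s := Finset.eq_of_subset_of_card_le (by grind)
      (by rw [hs, Finset.card_pair huv])
    refine ⟨_, extends_detour p q [] u v _ (by simp [huv, huv.symm]) ?_ ?_ ?_ ?_⟩
    · simp [huv.symm]
    · rintro ⟨x, t⟩
      simp [Finset.pair_comm]
      grind
    · simp [huv]
    · intro x hx y hy hxy
      have : x = u ∧ y = v ∨ x = v ∧ y = u := by grind
      rcases this with ⟨rfl, rfl⟩ | ⟨rfl, rfl⟩
      · exact .inl ⟨[], [x, y], rfl⟩
      · exact .inr ⟨[], [y, x], rfl⟩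
  · obtain ⟨w, hw⟩ : ∃ w, w ∈ s \ {u, v} := by
      rw [← Finset.Nonempty, ← Finset.card_pos, Finset.card_sdiff_of_subset (by grind), hs,
        Finset.card_pair huv]
      norm_num
    have hwu : w ≠ u := by grind
    have hwv : w ≠ v := by grind
    have h3 : ({u, v, w} : Finset α).card = 3 :=
      Finset.card_eq_three.2 ⟨u, v, w, huv, hwu.symm, hwv.symm, rfl⟩
    obtain rfl : {u, v, w} = s := Finset.eq_of_subset_of_card_le (by grind) (by rw [hs, h3])
    have e1 : ({v, w, u} : Finset α) = {u, v, w} := by ext; simp; tauto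
    have e2 : ({w, u, v} : Finset α) = {u, v, w} := by ext; simp; tauto
    refine ⟨_, extends_detour p q [w] u v _ (by simp [huv, hwu, hwv.symm]) ?_ ?_ ?_ ?_⟩
    · simp [huv.symm, hwu, hwv.symm]
    · rintro ⟨x, t⟩
      simp only [List.singleton_append, walkTypes_cons, walkTypes_pair, e1, e2]
      simp
      grind
    · simp [h3]
    · intro x hx y hy hxy
      have h1 : Consecutive [u, v, w, u, v] u v := .inl ⟨[], [w, u, v], rfl⟩
      have h2 : Consecutive [u, v, w, u, v] v w := .inl ⟨[u], [u, v], rfl⟩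
      have h3 : Consecutive [u, v, w, u, v] w u := .inl ⟨[u, v], [v], rfl⟩
      simp only [Finset.mem_insert, Finset.mem_singleton] at hx hy
      rcases hx with rfl | rfl | rfl <;> rcases hy with rfl | rfl | rfl <;>
        first | exact absurd rfl hxy | assumption | (apply Consecutive.symm; assumption)

theorem exists_extends (P : Finset (Finset α)) (l : List α)
    (hP : ∀ s ∈ P, (s.card = 2 ∨ s.card = 3) ∧
      ∃ u ∈ s, ∃ v ∈ s, u ≠ v ∧ Consecutive l u v) : ∃ l', Extends P l l' := by
  induction P using Finset.induction_on with
  | empty => exact ⟨l, .refl l⟩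
  | insert s P hs ih =>
    obtain ⟨l', hl'⟩ := ih fun t ht => hP t (Finset.mem_insert_of_mem ht)
    obtain ⟨hc, u, hu, v, hv, huv, h⟩ := hP s (Finset.mem_insert_self s P)
    obtain ⟨l'', hl''⟩ := exists_extends_singleton hc huv hu hv (hl'.mono u v h)
    refine ⟨l'', ?_⟩
    have := hl'.comp hl'' (Finset.disjoint_singleton_right.2 hs)
    rwa [Finset.union_comm, ← Finset.insert_eq] at this

/-- If all triangles at `a` are available, every further set of two or three entries can be
reached. -/
theorem exists_extends_of_star {a b : α} (hab : a ≠ b) (P : Finset (Finset α)) (l : List α)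
    (hl : Consecutive l a b) (hP : ∀ s ∈ P, s.card = 2 ∨ s.card = 3)
    (hstar : ∀ s : Finset α, s.card = 3 → a ∈ s →
      s ∈ P ∨ ∀ u ∈ s, ∀ v ∈ s, u ≠ v → Consecutive l u v) :
    ∃ l', Extends P l l' := by
  have ex_ne : ∀ s ∈ P, ∀ c, ∃ x ∈ s, x ≠ c := fun s hs c =>
    Finset.exists_mem_ne (by have := hP s hs; omega) c
  obtain ⟨l₁, h₁⟩ := exists_extends (P.filter fun s => a ∈ s ∧ b ∈ s) l fun s hs => by
    rw [Finset.mem_filter] at hs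
    exact ⟨hP s hs.1, a, hs.2.1, b, hs.2.2, hab, hl⟩
  -- The triple `{a, b, x}` has been visited, so `a` is now next to every color.
  have key₁ : ∀ x, x ≠ a → Consecutive l₁ a x := by
    intro x hx
    by_cases hxb : x = b
    · exact hxb ▸ h₁.mono _ _ hl
    · rcases hstar {a, b, x} (Finset.card_eq_three.2 ⟨a, b, x, hab, hx.symm, Ne.symm hxb, rfl⟩)
        (by simp) with h | h
      · exact h₁.new {a, b, x} (by simp [h]) a (by simp) x (by simp) hx.symm
      · exact h₁.mono _ _ (h a (by simp) x (by simp) hx.symm)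
  obtain ⟨l₂, h₂⟩ := exists_extends (P.filter fun s => a ∈ s ∧ b ∉ s) l₁ fun s hs => by
    rw [Finset.mem_filter] at hs
    obtain ⟨x, hx, hxa⟩ := ex_ne s hs.1 a
    exact ⟨hP s hs.1, a, hs.2.1, x, hx, hxa.symm, key₁ x hxa⟩
  -- All triples through `a` are now visited, and `{a, x, y}` puts `x` next to `y`.
  have key₂ : ∀ x y, x ≠ y → Consecutive l₂ x y := by
    intro x y hxy
    by_cases hx : x = a
    · subst hx
      exact h₂.mono _ _ (key₁ y hxy.symm)
    by_cases hy : y = a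
    · subst hy
      exact (h₂.mono _ _ (key₁ x hxy)).symm
    rcases hstar {a, x, y} (Finset.card_eq_three.2 ⟨a, x, y, Ne.symm hx, Ne.symm hy, hxy, rfl⟩)
        (by simp) with h | h
    · by_cases hb : b ∈ ({a, x, y} : Finset α)
      · exact h₂.mono _ _ (h₁.new {a, x, y} (Finset.mem_filter.2 ⟨h, by simp, hb⟩) x (by simp) y (by simp) hxy)
      · exact h₂.new {a, x, y} (Finset.mem_filter.2 ⟨h, by simp, hb⟩) x (by simp) y
          (by simp) hxy
    · exact h₂.mono _ _ (h₁.mono _ _ (h x (by simp) y (by simp) hxy))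
  obtain ⟨l₃, h₃⟩ := exists_extends (P.filter fun s => a ∉ s) l₂ fun s hs => by
    rw [Finset.mem_filter] at hs
    obtain ⟨x, hx, -⟩ := ex_ne s hs.1 a
    obtain ⟨y, hy, hyx⟩ := ex_ne s hs.1 x
    exact ⟨hP s hs.1, x, hx, y, hy, hyx.symm, key₂ x y hyx.symm⟩
  have hd₁ : Disjoint (P.filter fun s => a ∈ s ∧ b ∈ s) (P.filter fun s => a ∈ s ∧ b ∉ s) := by
    rw [Finset.disjoint_filter]
    tauto
  have hd₂ : Disjoint ((P.filter fun s => a ∈ s ∧ b ∈ s) ∪ P.filter fun s => a ∈ s ∧ b ∉ s)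
      (P.filter fun s => a ∉ s) := by
    rw [← Finset.filter_or, Finset.disjoint_filter]
    tauto
  refine ⟨l₃, ?_⟩
  convert (h₁.comp h₂ hd₁).comp h₃ hd₂ using 1
  ext s
  simp only [Finset.mem_union, Finset.mem_filter]
  tauto

end Walks

/-! ### Walks of prescribed length -/

section Construction

theorem choose_two_mul_two_add (k : ℕ) : 2 * k.choose 2 + k = k ^ 2 := by
  induction k with
  | zero => rfl
  | succ k ih =>
    rw [Nat.choose_succ_succ' k 1, Nat.choose_one_right]
    linarith [add_sq (k : ℕ) 1]

theorem ell_eq_mul_choose (k : ℕ) : ell k = k * k.choose 2 := by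
  have h1 := two_mul_ell_add k
  have h2 := choose_two_mul_two_add k
  nlinarith

theorem ell_eq (k : ℕ) : ell k = 3 * k.choose 3 + 2 * k.choose 2 := by
  induction k with
  | zero => rfl
  | succ k ih =>
    have h1 := choose_two_mul_two_add k
    rw [ell_eq_mul_choose] at ih ⊢
    rw [Nat.choose_succ_succ' k 2, Nat.choose_succ_succ' k 1, Nat.choose_one_right]
    nlinarith

theorem ell_lt_ell {j k : ℕ} (hk : 2 ≤ k) (h : j < k) : ell j < ell k := by
  rw [ell_eq_mul_choose, ell_eq_mul_choose]
  calc j * j.choose 2 ≤ j * k.choose 2 := Nat.mul_le_mul_left _ (Nat.choose_mono 2 h.le)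
    _ < k * k.choose 2 := Nat.mul_lt_mul_of_pos_right h (Nat.choose_pos hk)

theorem ell_mono {j k : ℕ} (h : j ≤ k) : ell j ≤ ell k := by
  rw [ell_eq_mul_choose, ell_eq_mul_choose]
  exact Nat.mul_le_mul h (Nat.choose_mono 2 h)

/-- Walks of length `n` that yield a coloring of both the path and the cycle. -/
structure IsGoodWalk {α : Type*} [DecidableEq α] (a b : α) (n : ℕ) (l : List α) : Prop where
  isChain : l.IsChain (· ≠ ·)
  nodup : (walkTypes l).Nodup
  length : l.length = n
  notMem : ∀ t ∈ walkTypes l, t.2 ≠ {a, b}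
  pre : [a, b] <+: l
  suf : [a, b] <:+ l

variable {α : Type*} [DecidableEq α]

theorem exists_isGoodWalk_of_finset {a b c : α} (hab : a ≠ b) (hca : c ≠ a) (hcb : c ≠ b)
    (P : Finset (Finset α)) (hP : ∀ s ∈ P, s.card = 2 ∨ s.card = 3)
    (hstar : ∀ s : Finset α, s.card = 3 → a ∈ s → s ∈ P) (habP : {a, b} ∈ P) :
    ∃ l, IsGoodWalk a b (∑ s ∈ P, s.card) l := by
  have e1 : ({b, c, a} : Finset α) = {a, b, c} := by ext; simp; tauto
  have e2 : ({c, a, b} : Finset α) = {a, b, c} := by ext; simp; tauto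
  have h3 : ({a, b, c} : Finset α).card = 3 :=
    Finset.card_eq_three.2 ⟨a, b, c, hab, hca.symm, hcb.symm, rfl⟩
  have h2 : ({a, b} : Finset α).card = 2 := Finset.card_pair hab
  have hne : ({a, b} : Finset α) ≠ {a, b, c} := fun h => by
    rw [h, h3] at h2
    omega
  have habc : {a, b, c} ∈ P := hstar _ h3 (by simp)
  have ht : ∀ t ∈ walkTypes [a, b, c, a, b], t.2 = {a, b, c} := by simp [e1, e2]
  have c1 : Consecutive [a, b, c, a, b] a b := .inl ⟨[], [c, a, b], rfl⟩
  have c2 : Consecutive [a, b, c, a, b] b c := .inl ⟨[a], [a, b], rfl⟩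
  have c3 : Consecutive [a, b, c, a, b] c a := .inl ⟨[a, b], [b], rfl⟩
  -- The seed has length 5: its three inner types exhaust `{a, b, c}`, and its two ends stand for
  -- the types over `{a, b}`. Hence both sets are removed from `P`.
  obtain ⟨l, hl⟩ := exists_extends_of_star hab ((P.erase {a, b, c}).erase {a, b})
    [a, b, c, a, b] c1 (fun s hs => hP s (Finset.mem_of_mem_erase (Finset.mem_of_mem_erase hs)))
    (by
      intro s hs has
      by_cases h : s = {a, b, c}
      · subst h
        right
        intro x hx y hy hxy
        simp only [Finset.mem_insert, Finset.mem_singleton] at hx hy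
        rcases hx with rfl | rfl | rfl <;> rcases hy with rfl | rfl | rfl <;>
          first | exact absurd rfl hxy | assumption | (apply Consecutive.symm; assumption)
      · left
        rw [Finset.mem_erase, Finset.mem_erase]
        exact ⟨by rintro rfl; omega, h, hstar s hs has⟩)
  refine ⟨l, hl.isChain (by simp [hab, hcb.symm, hca]), hl.nodup ?_ ?_, ?_, ?_, ?_, ?_⟩
  · simp [hab.symm, hcb.symm, hca]
  · intro t h
    simp [ht t h]
  · have h4 := Finset.add_sum_erase P Finset.card habc
    have h5 := Finset.add_sum_erase (P.erase {a, b, c}) Finset.card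
      (Finset.mem_erase.2 ⟨hne, habP⟩)
    rw [hl.length]
    simp only [List.length_cons, List.length_nil]
    omega
  · intro t h
    rcases (hl.mem t).1 h with h | h
    · rw [ht t h]
      exact hne.symm
    · exact (Finset.mem_erase.1 h.1).1
  · exact hl.pre _ _ ⟨[c, a, b], rfl⟩
  · exact hl.suf _ _ ⟨[a, b, c], rfl⟩

theorem card_star_le [Fintype α] (a : α) :
    ((Finset.univ.powersetCard 3).filter fun s : Finset α => a ∈ s).card ≤
      (Fintype.card α - 1).choose 2 := by
  rw [← Finset.card_univ, ← Finset.card_erase_of_mem (Finset.mem_univ a),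
    ← Finset.card_powersetCard]
  refine Finset.card_le_card_of_injOn (fun s => s.erase a) ?_ ?_
  · intro s hs
    simp only [Finset.coe_filter, Finset.mem_powersetCard, Set.mem_ofPred_eq] at hs
    simp only [Finset.mem_coe, Finset.mem_powersetCard]
    exact ⟨Finset.erase_subset_erase a hs.1.1, by rw [Finset.card_erase_of_mem hs.2]; omega⟩
  · intro s hs t ht h
    simp only [Finset.coe_filter, Set.mem_ofPred_eq] at hs ht
    simp only at h
    rw [← Finset.insert_erase hs.2, ← Finset.insert_erase ht.2, h]

theorem exists_isGoodWalk_add [Fintype α] {a b c : α} (hab : a ≠ b) (hca : c ≠ a) (hcb : c ≠ b)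
    {t e : ℕ} (ht : (Fintype.card α - 1).choose 2 ≤ t) (ht' : t ≤ (Fintype.card α).choose 3)
    (he : 1 ≤ e) (he' : e ≤ (Fintype.card α).choose 2) :
    ∃ l, IsGoodWalk a b (3 * t + 2 * e) l := by
  obtain ⟨T, hT, hT', hTc⟩ := Finset.exists_subsuperset_card_eq
    (Finset.filter_subset (fun s : Finset α => a ∈ s) (Finset.univ.powersetCard 3))
    ((card_star_le a).trans ht) (by simpa using ht')
  obtain ⟨E, hE, hE', hEc⟩ := Finset.exists_subsuperset_card_eq
    (s := {{a, b}}) (t := (Finset.univ : Finset α).powersetCard 2) (n := e)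
    (by simp [Finset.card_pair hab]) (by simpa using he) (by simpa using he')
  have hT3 : ∀ s ∈ T, s.card = 3 := fun s hs => (Finset.mem_powersetCard.1 (hT' hs)).2
  have hE2 : ∀ s ∈ E, s.card = 2 := fun s hs => (Finset.mem_powersetCard.1 (hE' hs)).2
  have hd : Disjoint T E := Finset.disjoint_left.2 fun s h1 h2 => by
    have := hT3 s h1
    have := hE2 s h2
    omega
  have := exists_isGoodWalk_of_finset hab hca hcb (T ∪ E)
    (fun s hs => (Finset.mem_union.1 hs).symm.imp (hE2 s) (hT3 s))
    (fun s hs has => Finset.mem_union_left _ (hT (by simp [hs, has])))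
    (Finset.mem_union_right _ (hE (by simp)))
  rwa [Finset.sum_union hd, Finset.sum_congr rfl hT3, Finset.sum_congr rfl hE2,
    Finset.sum_const, Finset.sum_const, hTc, hEc, smul_eq_mul, smul_eq_mul, mul_comm t,
    mul_comm e] at this

/-- Write n = 3t + 2e; giving up one triple corrects the parity. At 3·C(k-1,2) + 3 no triple can be
spared, and at ℓ(k) - 1 the pairs do not suffice. -/
theorem exists_isGoodWalk_of_le [Fintype α] {a b c : α} (hab : a ≠ b) (hca : c ≠ a)
    (hcb : c ≠ b) (hk : 4 ≤ Fintype.card α) {n : ℕ}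
    (hn : n = 3 * (Fintype.card α - 1).choose 2 + 2 ∨
      3 * (Fintype.card α - 1).choose 2 + 4 ≤ n)
    (hn' : n ≤ ell (Fintype.card α)) (hne : n ≠ ell (Fintype.card α) - 1) :
    ∃ l, IsGoodWalk a b n l := by
  rw [ell_eq] at hn' hne
  have h2 : 6 ≤ (Fintype.card α).choose 2 := Nat.choose_mono 2 hk
  have h3 : (Fintype.card α - 1).choose 2 + 1 ≤ (Fintype.card α).choose 3 := by
    obtain ⟨m, hm⟩ : ∃ m, Fintype.card α = m + 1 := ⟨Fintype.card α - 1, by omega⟩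
    rw [hm, Nat.choose_succ_succ' m 2, Nat.add_sub_cancel]
    have : 0 < m.choose (2 + 1) := Nat.choose_pos (by omega)
    omega
  suffices ∃ t e, n = 3 * t + 2 * e ∧ (Fintype.card α - 1).choose 2 ≤ t ∧
      t ≤ (Fintype.card α).choose 3 ∧ 1 ≤ e ∧ e ≤ (Fintype.card α).choose 2 by
    obtain ⟨t, e, rfl, h⟩ := this
    exact exists_isGoodWalk_add hab hca hcb h.1 h.2.1 h.2.2.1 h.2.2.2
  generalize (Fintype.card α).choose 2 = E at *
  generalize (Fintype.card α).choose 3 = T at *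
  generalize (Fintype.card α - 1).choose 2 = t₀ at *
  by_cases hT : 3 * T + 2 ≤ n
  · rcases Nat.even_or_odd' (n - 3 * T) with ⟨e, h | h⟩
    · exact ⟨T, e, by omega⟩
    · exact ⟨T - 1, e + 2, by omega⟩
  -- This quotient leaves a remainder of 2, 3 or 4 for the pairs.
  · rcases Nat.even_or_odd' (n - 3 * ((n - 2) / 3)) with ⟨e, h | h⟩
    · exact ⟨(n - 2) / 3, e, by omega⟩
    · exact ⟨(n - 2) / 3 - 1, e + 2, by omega⟩

theorem isGoodWalk_ten : IsGoodWalk (0 : Fin 4) 1 10 [0, 1, 3, 0, 1, 2, 0, 2, 0, 1] := by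
  constructor <;> decide

theorem isGoodWalk_twelve :
    IsGoodWalk (0 : Fin 4) 1 12 [0, 1, 3, 0, 1, 2, 1, 2, 0, 2, 0, 1] := by
  constructor <;> decide

theorem exists_isGoodWalk {k n : ℕ} (hk : 4 ≤ k) (hlow : ell (k - 1) < n) (hup : n ≤ ell k)
    (hne : n ≠ ell k - 1) : ∃ (a b : Fin k) (l : List (Fin k)), a ≠ b ∧ IsGoodWalk a b n l := by
  -- For `k = 4` the general lengths are 11 and those from 13 on, but `n` starts at `ell 3 + 1 =
  -- 10`.
  by_cases h : k = 4 ∧ (n = 10 ∨ n = 12)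
  · obtain ⟨rfl, rfl | rfl⟩ := h
    · exact ⟨0, 1, _, by decide, isGoodWalk_ten⟩
    · exact ⟨0, 1, _, by decide, isGoodWalk_twelve⟩
  · refine ⟨⟨0, by omega⟩, ⟨1, by omega⟩, ?_⟩
    obtain ⟨l, hl⟩ := exists_isGoodWalk_of_le (a := (⟨0, by omega⟩ : Fin k)) (b := ⟨1, by omega⟩)
      (c := ⟨2, by omega⟩) (by simp) (by simp) (by simp) (n := n) (by simpa using hk)
      (by
        rw [Fintype.card_fin]
        rw [ell_eq_mul_choose] at hlow
        rcases hk.eq_or_lt with rfl | hk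
        · have : Nat.choose (4 - 1) 2 = 3 := rfl
          rw [this] at hlow ⊢
          omega
        · have h1 : 6 ≤ (k - 1).choose 2 := Nat.choose_mono (a := 4) 2 (by omega)
          have h2 : 4 * (k - 1).choose 2 ≤ (k - 1) * (k - 1).choose 2 :=
            Nat.mul_le_mul_right _ (by omega)
          omega)
      (by simpa using hup) (by simpa using hne)
    exact ⟨l, by simp, hl⟩

theorem exists_isGoodWalk_succ {k : ℕ} (hk : 4 ≤ k) :
    ∃ (a b : Fin (k + 1)) (l : List (Fin (k + 1))), a ≠ b ∧ IsGoodWalk a b (ell k - 1) l := by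
  have hlt := ell_lt_ell (show 2 ≤ k + 1 by omega) (Nat.lt_succ_self k)
  have h1 : 6 ≤ k.choose 2 := Nat.choose_mono (a := 4) 2 hk
  have h2 : 4 * k.choose 2 ≤ k * k.choose 2 := Nat.mul_le_mul_right _ hk
  rw [← ell_eq_mul_choose] at h2
  obtain ⟨l, hl⟩ := exists_isGoodWalk_of_le (a := (⟨0, by omega⟩ : Fin (k + 1)))
    (b := ⟨1, by omega⟩) (c := ⟨2, by omega⟩) (by simp) (by simp) (by simp) (n := ell k - 1)
    (by simp; omega) (by simp; omega) (by simp; omega) (by simp; omega)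
  exact ⟨_, _, l, by simp, hl⟩

/-- A walk that yields a coloring of the path missing only the type `(a, {a, b, c})`. -/
theorem exists_walk_ell_sub_one [Fintype α] {a b c : α} (hab : a ≠ b) (hca : c ≠ a)
    (hcb : c ≠ b) : ∃ l : List α, l.IsChain (· ≠ ·) ∧ (walkTypes l).Nodup ∧
      l.length = ell (Fintype.card α) - 1 ∧ (c, {a, c}) ∉ walkTypes l ∧
      (b, {a, b}) ∉ walkTypes l ∧ [c, a] <+: l ∧ [a, b] <:+ l := by
  set A := (Finset.univ : Finset α).powersetCard 3 ∪ Finset.univ.powersetCard 2 with hA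
  have hd : Disjoint ((Finset.univ : Finset α).powersetCard 3) (Finset.univ.powersetCard 2) :=
    Finset.pairwise_disjoint_powersetCard _ (by norm_num)
  have hAc : ∑ s ∈ A, s.card = ell (Fintype.card α) := by
    rw [hA, Finset.sum_union hd, ell_eq,
      Finset.sum_congr rfl fun s hs => (Finset.mem_powersetCard.1 hs).2,
      Finset.sum_congr (s₁ := Finset.univ.powersetCard 2) rfl
        fun s hs => (Finset.mem_powersetCard.1 hs).2]
    simp [mul_comm]
  have h3 : ({a, b, c} : Finset α).card = 3 :=
    Finset.card_eq_three.2 ⟨a, b, c, hab, hca.symm, hcb.symm, rfl⟩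
  have h2 : ({a, b} : Finset α).card = 2 := Finset.card_pair hab
  have h2' : ({a, c} : Finset α).card = 2 := Finset.card_pair hca.symm
  have hne : ({a, b} : Finset α) ≠ {a, b, c} := fun h => by
    rw [h, h3] at h2
    omega
  have hne' : ({a, c} : Finset α) ≠ {a, b, c} := fun h => by
    rw [h, h3] at h2'
    omega
  have hne'' : ({a, c} : Finset α) ≠ {a, b} := fun h => by
    have : c ∈ ({a, b} : Finset α) := h ▸ by simp
    simp [hca, hcb] at this
  have e1 : ({a, c, b} : Finset α) = {a, b, c} := by ext; simp; tauto
  have e2 : ({c, a, b} : Finset α) = {a, b, c} := by ext; simp; tauto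
  have e4 : ({b, a} : Finset α) = {a, b} := Finset.pair_comm ..
  have hw : walkTypes [c, a, c, b, a, b] =
      [(a, {a, c}), (c, {a, b, c}), (b, {a, b, c}), (a, {a, b})] := by
    simp [e1, e2, e4]
  have c1 : Consecutive [c, a, c, b, a, b] a b := .inl ⟨[c, a, c, b], [], rfl⟩
  have c2 : Consecutive [c, a, c, b, a, b] b c := .inr ⟨[c, a], [a, b], rfl⟩
  have c3 : Consecutive [c, a, c, b, a, b] c a := .inl ⟨[], [c, b, a, b], rfl⟩
  have hmem : ∀ s, s ∈ ((A.erase {a, b, c}).erase {a, b}).erase {a, c} ↔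
      s ≠ {a, c} ∧ s ≠ {a, b} ∧ s ≠ {a, b, c} ∧ (s.card = 2 ∨ s.card = 3) := by
    intro s
    simp [hA, or_comm]
  -- The three removed sets carry seven types. The seed has four of them inside, its ends will give
  -- `(c, {a, c})` and `(b, {a, b})`, and `(a, {a, b, c})` is lost.
  obtain ⟨l, hl⟩ := exists_extends_of_star hab (((A.erase {a, b, c}).erase {a, b}).erase {a, c})
    [c, a, c, b, a, b] c1 (fun s hs => ((hmem s).1 hs).2.2.2)
    (by
      intro s hs has
      by_cases h : s = {a, b, c}
      · subst h
        right
        intro x hx y hy hxy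
        simp only [Finset.mem_insert, Finset.mem_singleton] at hx hy
        rcases hx with rfl | rfl | rfl <;> rcases hy with rfl | rfl | rfl <;>
          first | exact absurd rfl hxy | assumption | (apply Consecutive.symm; assumption)
      · left
        rw [hmem]
        exact ⟨by rintro rfl; omega, by rintro rfl; omega, h, .inr hs⟩)
  refine ⟨l, hl.isChain (by simp [hab, hcb, hca, hca.symm, hab.symm]), hl.nodup ?_ ?_, ?_,
    ?_, ?_, ?_, ?_⟩
  · rw [hw]
    simp [hca, hcb, hab, hne'', hca.symm, hab.symm]
  · intro t h
    rw [hw] at h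
    rw [hmem]
    simp only [List.mem_cons, List.not_mem_nil, or_false] at h
    rcases h with rfl | rfl | rfl | rfl <;> simp
  · have h4 := Finset.add_sum_erase A Finset.card (a := {a, b, c}) (by simp [hA, h3])
    have h5 := Finset.add_sum_erase (A.erase {a, b, c}) Finset.card (a := {a, b})
      (by rw [Finset.mem_erase]; exact ⟨hne, by simp [hA, h2]⟩)
    have h6 := Finset.add_sum_erase ((A.erase {a, b, c}).erase {a, b}) Finset.card (a := {a, c})
      (by rw [Finset.mem_erase, Finset.mem_erase]; exact ⟨hne'', hne', by simp [hA, h2']⟩)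
    rw [hl.length]
    simp only [List.length_cons, List.length_nil]
    omega
  · rw [hl.mem, hmem, hw]
    simp [hca, hcb, hne']
  · rw [hl.mem, hmem, hw]
    simp [hab.symm, hcb.symm, hne]
  · exact hl.pre _ _ ⟨[c, b, a, b], rfl⟩
  · exact hl.suf _ _ ⟨[c, a, c, b], rfl⟩

end Construction

/-! ### Counting types; the balance of edge ends -/

section Types

variable {V α : Type*} [DecidableEq α]

/-- The type of a vertex `v` with neighbors `f v` and `g v`: its color, and the set of the colors
of `v` and its neighbors. -/
def vertexType (f g : V → V) (c : V → α) (v : V) : α × Finset α :=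
  (c v, {c (f v), c v, c (g v)})

/-- Properness keeps the color of `v` off its neighbors, so joining it to their colors loses no
information. The maps `f` and `g` may agree, as at the end of a path. -/
theorem isNLColoring_iff {G : SimpleGraph V} {f g : V → V}
    (hG : ∀ v w, G.Adj v w ↔ w = f v ∨ w = g v) (c : G.Coloring α) :
    IsNLColoring G c ↔ Function.Injective (vertexType f g c) := by
  have hf : ∀ v, c v ≠ c (f v) := fun v => c.valid ((hG v _).2 (.inl rfl))
  have hg : ∀ v, c v ≠ c (g v) := fun v => c.valid ((hG v _).2 (.inr rfl))
  have hn : ∀ v, neighborColors G c v =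
      (((vertexType f g c v).2.erase (vertexType f g c v).1 : Finset α) : Set α) := by
    intro v
    have h1 := hf v
    have h2 := hg v
    ext j
    simp only [neighborColors, SimpleGraph.mem_neighborSet, hG, vertexType, Finset.coe_erase,
      Set.mem_ofPred_eq, Set.mem_sdiff, Finset.mem_coe, Finset.mem_insert, Finset.mem_singleton,
      Set.mem_singleton_iff]
    grind
  have hmem : ∀ v, (vertexType f g c v).1 ∈ (vertexType f g c v).2 := by simp [vertexType]
  constructor
  · intro h u v huv
    by_contra hne
    exact h u v hne (congrArg Prod.fst huv) (by rw [hn, hn, huv])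
  · intro h u v hne hc heq
    refine hne (h (Prod.ext hc ?_))
    rw [hn, hn, Finset.coe_inj] at heq
    rw [← Finset.insert_erase (hmem u), ← Finset.insert_erase (hmem v), heq]
    congr 1

variable [Fintype α]

/-- All possible types of a vertex with one or two neighbors. -/
def allTypes (α : Type*) [DecidableEq α] [Fintype α] : Finset (α × Finset α) :=
  Finset.univ.filter fun t => t.1 ∈ t.2 ∧ (t.2.card = 2 ∨ t.2.card = 3)

theorem card_allTypes : (allTypes α).card = ell (Fintype.card α) := by
  have hA : ∀ t ∈ allTypes α, t.2 ∈
      (Finset.univ : Finset α).powersetCard 3 ∪ Finset.univ.powersetCard 2 := by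
    intro t ht
    simp only [allTypes, Finset.mem_filter] at ht
    simp [ht.2.2.symm]
  have hd : Disjoint ((Finset.univ : Finset α).powersetCard 3) (Finset.univ.powersetCard 2) :=
    Finset.pairwise_disjoint_powersetCard _ (by norm_num)
  have hfib : ∀ s : Finset α, s.card = 2 ∨ s.card = 3 →
      ((allTypes α).filter fun t => t.2 = s).card = s.card := by
    intro s hs
    rw [← Finset.card_image_of_injective s (f := fun i => (i, s)) fun i j h => congrArg Prod.fst h]
    congr 1
    ext ⟨i, t⟩
    simp only [allTypes, Finset.mem_filter, Finset.mem_univ, true_and, Finset.mem_image,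
      Prod.mk.injEq]
    grind
  rw [Finset.card_eq_sum_card_fiberwise hA, Finset.sum_union hd, ell_eq,
    Finset.sum_congr rfl fun s hs => (hfib s (.inr (Finset.mem_powersetCard.1 hs).2)).trans
      (Finset.mem_powersetCard.1 hs).2,
    Finset.sum_congr (s₁ := Finset.univ.powersetCard 2) rfl
      fun s hs => (hfib s (.inl (Finset.mem_powersetCard.1 hs).2)).trans
        (Finset.mem_powersetCard.1 hs).2]
  simp [mul_comm]

omit [Fintype α] in
theorem card_triple {a b c : α} (hba : b ≠ a) (hbc : b ≠ c) :
    ({a, b, c} : Finset α).card = if a = c then 2 else 3 := by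
  split_ifs with h
  · subst h
    rw [Finset.insert_comm, Finset.pair_eq_singleton, Finset.card_pair hba]
  · exact Finset.card_eq_three.2 ⟨a, b, c, hba.symm, h, hbc, rfl⟩

theorem vertexType_mem {f g : V → V} {c : V → α} (hf : ∀ v, c v ≠ c (f v))
    (hg : ∀ v, c v ≠ c (g v)) (v : V) : vertexType f g c v ∈ allTypes α := by
  simp only [allTypes, vertexType, Finset.mem_filter, Finset.mem_univ, true_and,
    card_triple (hf v) (hg v)]
  refine ⟨by simp, ?_⟩
  split_ifs <;> simp

variable [Fintype V]

theorem card_le_ell {f g : V → V} {c : V → α} (hf : ∀ v, c v ≠ c (f v))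
    (hg : ∀ v, c v ≠ c (g v)) (h : Function.Injective (vertexType f g c)) :
    Fintype.card V ≤ ell (Fintype.card α) := by
  rw [← card_allTypes, ← Finset.card_univ]
  exact Finset.card_le_card_of_injOn _ (fun v _ => vertexType_mem hf hg v) h.injOn

/-- The weight of a type in counting the sides at `x` of the edges colored `x, y`. -/
def sideWeight (x y : α) (t : α × Finset α) : ℕ :=
  if t.1 = x ∧ y ∈ t.2 then 4 - t.2.card else 0

/-- Each set through `x` and `y` contributes through one type only, with a weight that depends only
on its size. -/
theorem sum_sideWeight_comm (x y : α) :
    ∑ t ∈ allTypes α, sideWeight x y t = ∑ t ∈ allTypes α, sideWeight y x t := by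
  have key : ∀ x y : α, ∑ t ∈ allTypes α, sideWeight x y t = ∑ s : Finset α,
      if x ∈ s ∧ y ∈ s ∧ (s.card = 2 ∨ s.card = 3) then 4 - s.card else 0 := by
    intro x y
    rw [allTypes, Finset.sum_filter, Fintype.sum_prod_type_right]
    refine Finset.sum_congr rfl fun s _ => ?_
    rw [Finset.sum_eq_single x]
    · simp only [sideWeight]
      grind
    · intro i _ hi
      simp [sideWeight, hi]
    · simp
  rw [key, key]
  exact Finset.sum_congr rfl fun s _ => by simp only [← and_assoc, and_comm (a := x ∈ s)]

-- At a vertex colored `x`, the weight is the number of its two neighbors along `σ` colored `y`.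
-- Each edge colored `x, y` thus counts once from either end.
omit [Fintype α] in
theorem sum_sideWeight_vertexType_comm (σ : Equiv.Perm V) {c : V → α} (hc : ∀ v, c v ≠ c (σ v))
    {x y : α} (hxy : x ≠ y) : ∑ v, sideWeight x y (vertexType σ.symm σ c v) =
      ∑ v, sideWeight y x (vertexType σ.symm σ c v) := by
  have hc' : ∀ v, c v ≠ c (σ.symm v) := fun v => by
    simpa using (hc (σ.symm v)).symm
  have key : ∀ x y : α, x ≠ y → ∑ v, sideWeight x y (vertexType σ.symm σ c v) =
      (∑ v, if c v = x ∧ c (σ v) = y then 1 else 0) +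
        ∑ v, if c v = y ∧ c (σ v) = x then 1 else 0 := by
    intro x y hxy
    rw [← Equiv.sum_comp σ.symm fun v => if c v = y ∧ c (σ v) = x then 1 else 0,
      ← Finset.sum_add_distrib]
    refine Finset.sum_congr rfl fun v _ => ?_
    have h1 := hc v
    have h2 := hc' v
    simp only [sideWeight, vertexType, card_triple h2 h1, Finset.mem_insert,
      Finset.mem_singleton, Equiv.apply_symm_apply]
    grind
  rw [key x y hxy, key y x hxy.symm, add_comm]

/-- A closed walk cannot use all types but one. -/
theorem card_add_one_ne_ell (σ : Equiv.Perm V) {c : V → α} (hc : ∀ v, c v ≠ c (σ v))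
    (h : Function.Injective (vertexType σ.symm σ c)) :
    Fintype.card V + 1 ≠ ell (Fintype.card α) := by
  intro hcard
  have hc' : ∀ v, c v ≠ c (σ.symm v) := fun v => by
    simpa using (hc (σ.symm v)).symm
  have hsub : Finset.univ.image (vertexType σ.symm σ c) ⊆ allTypes α := by
    intro t ht
    obtain ⟨v, -, rfl⟩ := Finset.mem_image.1 ht
    exact vertexType_mem hc' hc v
  have hc1 : (allTypes α \ Finset.univ.image (vertexType σ.symm σ c)).card = 1 := by
    rw [Finset.card_sdiff_of_subset hsub, card_allTypes, Finset.card_image_of_injective _ h,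
      Finset.card_univ]
    omega
  obtain ⟨⟨x, s⟩, hm⟩ := Finset.card_eq_one.1 hc1
  have hsum : ∀ w : α × Finset α → ℕ,
      w (x, s) + ∑ v, w (vertexType σ.symm σ c v) = ∑ t ∈ allTypes α, w t := by
    intro w
    rw [← Finset.sum_sdiff hsub, hm, Finset.sum_singleton, Finset.sum_image h.injOn]
  have hxs : (x, s) ∈ allTypes α := by
    have : (x, s) ∈ allTypes α \ Finset.univ.image (vertexType σ.symm σ c) := by simp [hm]
    exact (Finset.mem_sdiff.1 this).1
  simp only [allTypes, Finset.mem_filter, Finset.mem_univ, true_and] at hxs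
  -- The missing type has positive weight for `x, y` and weight zero for `y, x`, while both totals
  -- are symmetric.
  obtain ⟨y, hy, hyx⟩ := Finset.exists_mem_ne (show 1 < s.card by omega) x
  have h1 := hsum (sideWeight x y)
  have h2 := hsum (sideWeight y x)
  rw [sum_sideWeight_comm, ← h2, sum_sideWeight_vertexType_comm σ hc hyx.symm] at h1
  simp only [sideWeight, hy, hyx.symm, and_self, false_and, if_true, if_false] at h1
  omega

omit [Fintype α] [Fintype V] in
theorem injective_vertexType_subtype {p : α → Prop} {f g : V → V} {c : V → α}
    (h : Function.Injective (vertexType f g c)) (hp : ∀ v, p (c v)) :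
    Function.Injective (vertexType f g fun v => (⟨c v, hp v⟩ : {x // p x})) := by
  refine Function.Injective.of_comp (f := Prod.map Subtype.val (Finset.image Subtype.val)) ?_
  convert h using 1
  ext v <;> simp [vertexType]

end Types

/-! ### From walks to colorings -/

section Coloring

variable {α : Type*} [DecidableEq α]

/-- The walk `m` has one auxiliary entry at each end, so vertex `v` sits at index `v + 1`. -/
theorem exists_coloring_of_walk {n : ℕ} {m : List α} (hm : m.length = n + 2)
    (hchain : m.IsChain (· ≠ ·)) (hnodup : (walkTypes m).Nodup) {f g : Fin n → Fin n}
    (hf : ∀ v : Fin n, m[(v : ℕ)]? = m[(f v : ℕ) + 1]?)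
    (hg : ∀ v : Fin n, m[(v : ℕ) + 2]? = m[(g v : ℕ) + 1]?) :
    ∃ c : Fin n → α, (∀ v, c v ≠ c (f v)) ∧ (∀ v, c v ≠ c (g v)) ∧
      Function.Injective (vertexType f g c) := by
  rw [List.isChain_iff_getElem] at hchain
  have hf' : ∀ v : Fin n, m[(v : ℕ)] = m[(f v : ℕ) + 1] := fun v => by
    have := hf v
    rwa [List.getElem?_eq_getElem (by omega), List.getElem?_eq_getElem (by omega),
      Option.some_inj] at this
  have hg' : ∀ v : Fin n, m[(v : ℕ) + 2] = m[(g v : ℕ) + 1] := fun v => by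
    have := hg v
    rwa [List.getElem?_eq_getElem (by omega), List.getElem?_eq_getElem (by omega),
      Option.some_inj] at this
  refine ⟨fun v => m[(v : ℕ) + 1], fun v => ?_, fun v => ?_, fun u v huv => ?_⟩
  · simp only [← hf']
    exact (hchain v (by omega)).symm
  · simp only [← hg']
    exact hchain (v + 1) (by omega)
  · have hlen := length_walkTypes m
    have key : ∀ v : Fin n, vertexType f g (fun v : Fin n => m[(v : ℕ) + 1]) v =
        (walkTypes m)[(v : ℕ)]'(by omega) := by
      intro v
      rw [getElem_walkTypes _ _ (by omega)]
      simp only [vertexType, ← hf', ← hg']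
    rw [key, key, hnodup.getElem_inj_iff] at huv
    exact Fin.ext huv

end Coloring

/-! ### Paths and cycles -/

section Graphs

/-- The predecessor of a vertex of a path; for the first vertex, its only neighbor. -/
def pathPrev {n : ℕ} (hn : 2 ≤ n) (v : Fin n) : Fin n :=
  ⟨if v.val = 0 then 1 else v.val - 1, by split_ifs <;> omega⟩

/-- The successor of a vertex of a path; for the last vertex, its only neighbor. -/
def pathNext {n : ℕ} (hn : 2 ≤ n) (v : Fin n) : Fin n :=
  ⟨if v.val + 1 = n then n - 2 else v.val + 1, by split_ifs <;> omega⟩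

theorem pathGraph_adj_iff {n : ℕ} (hn : 2 ≤ n) (v w : Fin n) :
    (SimpleGraph.pathGraph n).Adj v w ↔ w = pathPrev hn v ∨ w = pathNext hn v := by
  simp only [SimpleGraph.pathGraph_adj, pathPrev, pathNext, Fin.ext_iff]
  split_ifs <;> omega

theorem cycleGraph_adj_iff {n : ℕ} (v w : Fin (n + 2)) :
    (SimpleGraph.cycleGraph (n + 2)).Adj v w ↔
      w = (Equiv.addRight (1 : Fin (n + 2))).symm v ∨ w = Equiv.addRight (1 : Fin (n + 2)) v := by
  rw [← SimpleGraph.mem_neighborSet, SimpleGraph.cycleGraph_neighborSet]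
  simp [sub_eq_add_neg]

variable {α : Type*} [DecidableEq α]

theorem exists_pathGraph_coloring {n : ℕ} (hn : 2 ≤ n) {l : List α} (hl : l.length = n)
    (hchain : l.IsChain (· ≠ ·)) (hnodup : (walkTypes l).Nodup) {x y z w : α}
    (hpre : [x, y] <+: l) (hsuf : [z, w] <:+ l) (hxw : x ≠ w)
    (hx : (x, {y, x}) ∉ walkTypes l) (hw : (w, {z, w}) ∉ walkTypes l) :
    ∃ c : Fin n → α, (∀ v, c v ≠ c (pathPrev hn v)) ∧ (∀ v, c v ≠ c (pathNext hn v)) ∧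
      Function.Injective (vertexType (pathPrev hn) (pathNext hn) c) := by
  obtain ⟨r, hr⟩ := hpre
  obtain ⟨q, hq⟩ := hsuf
  have hyx : y ≠ x := by
    rw [← hr] at hchain
    simp at hchain
    exact Ne.symm hchain.1
  have hwz : w ≠ z := by
    rw [← hq] at hchain
    have := hchain.right_of_append
    simp at this
    exact Ne.symm this
  -- Adding `z` after `w` and `y` before `x` shows each end vertex its only neighbor on both sides.
  have hc1 : (l ++ [z]).IsChain (· ≠ ·) := by
    rw [← hq] at hchain ⊢
    rw [List.append_assoc]
    exact List.isChain_append_cons_cons.2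
      ⟨(List.isChain_append_cons_cons.1 hchain).1, hwz.symm, by simp [hwz]⟩
  have hc2 : (y :: (l ++ [z])).IsChain (· ≠ ·) := by
    rw [← hr] at hc1 ⊢
    exact List.isChain_cons_cons.2 ⟨hyx, hc1⟩
  have ht1 : walkTypes (l ++ [z]) = walkTypes l ++ [(w, {z, w})] := by
    rw [← hq, List.append_assoc]
    refine (walkTypes_append q z w [z]).trans ?_
    have : ({z, w, z} : Finset α) = {z, w} := by ext; simp; tauto
    simp [this]
  have ht2 : walkTypes (y :: (l ++ [z])) = (x, {y, x}) :: walkTypes (l ++ [z]) := by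
    rw [← hr]
    have : ({y, x, y} : Finset α) = {y, x} := by ext; simp; tauto
    simp [this]
  refine exists_coloring_of_walk (m := y :: (l ++ [z])) (by simp [hl]) hc2 ?_ ?_ ?_
  · rw [ht2, ht1]
    simp only [List.nodup_cons, List.nodup_append, List.mem_append, List.mem_singleton,
      Prod.mk.injEq, hxw, false_and, or_false]
    refine ⟨hx, hnodup, by simp, ?_⟩
    rintro t ht _ rfl rfl
    exact hw ht
  · rintro ⟨v, hv⟩
    rcases v with _ | v
    · simp [pathPrev, ← hr]
    · simp [pathPrev]
  · rintro ⟨v, hv⟩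
    by_cases h : v + 1 = n
    · have hq' : q.length = n - 2 := by
        have := congrArg List.length hq
        simp at this
        omega
      have h1 : n - 2 = q.length := hq'.symm
      simp only [pathNext, h, if_true, List.getElem?_cons_succ]
      rw [← hl, List.getElem?_concat_length, hl, h1, ← hq]
      simp
    · simp [pathNext, h]

theorem IsGoodWalk.exists_pathGraph_coloring {a b : α} (hab : a ≠ b) {n : ℕ} (hn : 2 ≤ n)
    {l : List α} (h : IsGoodWalk a b n l) :
    ∃ c : Fin n → α, (∀ v, c v ≠ c (pathPrev hn v)) ∧ (∀ v, c v ≠ c (pathNext hn v)) ∧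
      Function.Injective (vertexType (pathPrev hn) (pathNext hn) c) :=
  NeighborLocating.exists_pathGraph_coloring hn h.length h.isChain h.nodup h.pre h.suf hab
    (fun ht => h.notMem _ ht (Finset.pair_comm ..)) (fun ht => h.notMem _ ht rfl)

theorem IsGoodWalk.exists_cycleGraph_coloring {a b : α} (hab : a ≠ b) {n : ℕ}
    {l : List α} (h : IsGoodWalk a b (n + 2) l) :
    ∃ c : Fin (n + 2) → α, (∀ v, c v ≠ c ((Equiv.addRight (1 : Fin (n + 2))).symm v)) ∧
      (∀ v, c v ≠ c (Equiv.addRight (1 : Fin (n + 2)) v)) ∧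
      Function.Injective (vertexType (Equiv.addRight (1 : Fin (n + 2))).symm
        (Equiv.addRight (1 : Fin (n + 2))) c) := by
  obtain ⟨r, hr⟩ := h.pre
  obtain ⟨q, hq⟩ := h.suf
  have hl := h.length
  have hq' : q.length = n := by
    have := congrArg List.length hq
    simp at this
    omega
  have ht : walkTypes (a :: b :: l) = (b, {a, b}) :: (a, {a, b}) :: walkTypes l := by
    rw [← hr]
    have h1 : ({a, b, a} : Finset α) = {a, b} := by ext; simp; tauto
    have h2 : ({b, a, b} : Finset α) = {a, b} := by ext; simp
    simp [h1, h2]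
  -- The prefix copies the last two entries of `l`: vertex 0 takes the final `b`, and every later
  -- vertex `v` takes entry `v - 1` of `l`.
  refine exists_coloring_of_walk (m := a :: b :: l) (by simp [hl]) ?_ ?_ ?_ ?_
  · have := h.isChain
    rw [← hr] at this ⊢
    exact List.isChain_cons_cons.2 ⟨hab, List.isChain_cons_cons.2 ⟨hab.symm, this⟩⟩
  · rw [ht]
    simp only [List.nodup_cons, List.mem_cons, Prod.mk.injEq, not_or]
    exact ⟨⟨fun h => hab h.1.symm, fun ht => h.notMem _ ht rfl⟩, fun ht => h.notMem _ ht rfl,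
      h.nodup⟩
  · intro v
    obtain ⟨u, rfl⟩ := (Equiv.addRight (1 : Fin (n + 2))).surjective v
    rw [Equiv.symm_apply_apply, Equiv.coe_addRight]
    by_cases hu : u = Fin.last (n + 1)
    · subst hu
      simp [← hq, ← hq']
    · rw [Fin.val_add_one_of_lt (Fin.lt_last_iff_ne_last.2 hu)]
  · intro u
    rw [Equiv.coe_addRight]
    by_cases hu : u = Fin.last (n + 1)
    · subst hu
      simp [← hq, ← hq']
    · rw [Fin.val_add_one_of_lt (Fin.lt_last_iff_ne_last.2 hu)]

end Graphs

/-! ### Chromatic numbers -/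

section ChromaticNumber

variable {V : Type*} [Fintype V] {G : SimpleGraph V} {f g : V → V}

theorem card_le_ell_chiNL (hG : ∀ v w, G.Adj v w ↔ w = f v ∨ w = g v) :
    Fintype.card V ≤ ell (chiNL G) := by
  obtain ⟨c, -, hc⟩ := (isLeast_chiNL G).1
  simpa using card_le_ell (c := c) (fun v => c.valid ((hG v _).2 (.inl rfl)))
    (fun v => c.valid ((hG v _).2 (.inr rfl))) ((isNLColoring_iff hG c).1 hc)

omit [Fintype V] in
theorem hasNLColoring_of_surjective (hG : ∀ v w, G.Adj v w ↔ w = f v ∨ w = g v) {k : ℕ}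
    {c : V → Fin k} (hf : ∀ v, c v ≠ c (f v)) (hg : ∀ v, c v ≠ c (g v))
    (hc : Function.Injective (vertexType f g c)) (hs : Function.Surjective c) :
    HasNLColoring G k := by
  refine ⟨SimpleGraph.Coloring.mk c ?_, hs, (isNLColoring_iff hG _).2 hc⟩
  intro v w hvw
  rcases (hG v w).1 hvw with rfl | rfl
  · exact hf v
  · exact hg v

theorem chiNL_eq (hG : ∀ v w, G.Adj v w ↔ w = f v ∨ w = g v) {k : ℕ}
    (hk : ell (k - 1) < Fintype.card V) {c : V → Fin k} (hf : ∀ v, c v ≠ c (f v))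
    (hg : ∀ v, c v ≠ c (g v)) (hc : Function.Injective (vertexType f g c)) : chiNL G = k := by
  -- An unused color could be dropped, and `k - 1` colors have too few types.
  have hs : Function.Surjective c := by
    by_contra hs
    obtain ⟨y, hy⟩ := not_forall.1 hs
    have hp : ∀ v, c v ≠ y := fun v hv => hy ⟨v, hv⟩
    have := card_le_ell (c := fun v => (⟨c v, hp v⟩ : {x // x ≠ y}))
      (fun v h => hf v (congrArg Subtype.val h)) (fun v h => hg v (congrArg Subtype.val h))
      (injective_vertexType_subtype hc hp)
    rw [Fintype.card_subtype_compl, Fintype.card_fin, Fintype.card_subtype_eq] at this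
    omega
  refine le_antisymm ((isLeast_chiNL G).2 (hasNLColoring_of_surjective hG hf hg hc hs)) ?_
  by_contra h
  have := (card_le_ell_chiNL hG).trans (ell_mono (show chiNL G ≤ k - 1 by omega))
  omega

/-- A 2-regular graph with `ell k - 1` vertices is not colorable with `k` colors. -/
theorem chiNL_eq_succ {σ : Equiv.Perm V} (hG : ∀ v w, G.Adj v w ↔ w = σ.symm v ∨ w = σ v) {k : ℕ}
    (hk : Fintype.card V + 1 = ell k) (hk' : ell (k - 1) < Fintype.card V)
    {c : V → Fin (k + 1)} (hf : ∀ v, c v ≠ c (σ.symm v))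
    (hg : ∀ v, c v ≠ c (σ v)) (hc : Function.Injective (vertexType σ.symm σ c)) :
    chiNL G = k + 1 := by
  -- Dropping an unused color would color `ell k - 1` vertices with `k` colors, against the balance.
  have hs : Function.Surjective c := by
    by_contra hs
    obtain ⟨y, hy⟩ := not_forall.1 hs
    have hp : ∀ v, c v ≠ y := fun v hv => hy ⟨v, hv⟩
    refine card_add_one_ne_ell σ (c := fun v => (⟨c v, hp v⟩ : {x // x ≠ y}))
      (fun v h => hg v (congrArg Subtype.val h)) (injective_vertexType_subtype hc hp) ?_
    rw [Fintype.card_subtype_compl, Fintype.card_fin, Fintype.card_subtype_eq]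
    exact hk
  refine le_antisymm ((isLeast_chiNL G).2 (hasNLColoring_of_surjective hG hf hg hc hs)) ?_
  by_contra h
  rcases (show chiNL G ≤ k by omega).eq_or_lt with h | h
  · obtain ⟨c', -, hc'⟩ := (isLeast_chiNL G).1
    refine card_add_one_ne_ell σ (c := c') (fun v => c'.valid ((hG v _).2 (.inr rfl)))
      ((isNLColoring_iff hG c').1 hc') ?_
    rw [Fintype.card_fin, h]
    exact hk
  · have := (card_le_ell_chiNL hG).trans (ell_mono (show chiNL G ≤ k - 1 by omega))
    omega

end ChromaticNumber

end NeighborLocating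

open NeighborLocating in
theorem mainTheorem1 (k n : ℕ) (hk : 4 ≤ k)
    (hlow : NeighborLocating.ell (k - 1) < n) (hup : n ≤ NeighborLocating.ell k) :
    NeighborLocating.chiNL (SimpleGraph.pathGraph n) = k ∧
    (n ≠ NeighborLocating.ell k - 1 →
      NeighborLocating.chiNL (SimpleGraph.cycleGraph n) = k) ∧
    (n = NeighborLocating.ell k - 1 →
      NeighborLocating.chiNL (SimpleGraph.cycleGraph n) = k + 1) := by
  have h9 : 9 ≤ ell (k - 1) := ell_mono (j := 3) (by omega)
  obtain ⟨m, rfl⟩ : ∃ m, n = m + 2 := ⟨n - 2, by omega⟩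
  have hm : 2 ≤ m + 2 := by omega
  refine ⟨?_, fun hne => ?_, fun heq => ?_⟩
  · by_cases hne : m + 2 = ell k - 1
    · obtain ⟨l, hchain, hnodup, hl, hx, hw, hpre, hsuf⟩ := exists_walk_ell_sub_one
        (a := (⟨0, by omega⟩ : Fin k)) (b := ⟨1, by omega⟩) (c := ⟨2, by omega⟩)
        (by simp) (by simp) (by simp)
      rw [Fintype.card_fin, ← hne] at hl
      obtain ⟨c, hf, hg, hc⟩ := exists_pathGraph_coloring hm hl hchain hnodup hpre hsuf (by simp)
        hx hw
      exact chiNL_eq (pathGraph_adj_iff hm) (by simpa using hlow) hf hg hc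
    · obtain ⟨a, b, l, hab, hl⟩ := exists_isGoodWalk hk hlow hup hne
      obtain ⟨c, hf, hg, hc⟩ := hl.exists_pathGraph_coloring hab hm
      exact chiNL_eq (pathGraph_adj_iff hm) (by simpa using hlow) hf hg hc
  · obtain ⟨a, b, l, hab, hl⟩ := exists_isGoodWalk hk hlow hup hne
    obtain ⟨c, hf, hg, hc⟩ := hl.exists_cycleGraph_coloring hab
    exact chiNL_eq cycleGraph_adj_iff (by simpa using hlow) hf hg hc
  · obtain ⟨a, b, l, hab, hl⟩ := exists_isGoodWalk_succ hk
    rw [← heq] at hl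
    obtain ⟨c, hf, hg, hc⟩ := hl.exists_cycleGraph_coloring hab
    exact chiNL_eq_succ cycleGraph_adj_iff (by simp; omega) (by simpa using hlow) hf hg hc
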